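/- **Definitions.** A universal Horn sentence in the language of lattices is a statement $$\forall x_1\cdots\forall x_k\;\bigl[P_1(x)=Q_1(x)\ \text{and}\ \cdots\ \text{and}\ P_m(x)=Q_m(x)\ \text{implies}\ P(x)=Q(x)\bigr],\qquad m\ge 0,$$ where $P_i,Q_i,P,Q$ are formulas built from the variables $x_1,\dots,x_k$ with $\vee$ and $\wedge$; $k$ is its number of variables, and for $m=0$ it is an identity. For $n\ge 2$, a lattice $L$ satisfies $D_n$ if for all $a_1,\dots,a_n,b_1,\dots,b_n\in L$ $$ a_n \wedge \Bigl( \Bigl[ \bigwedge_{i=1}^{n-1} (a_i \vee b_i) \Bigr] \vee b_n \Bigr) \leq a_1 \vee \Bigl( \Bigl[ \bigvee_{i=1}^{n-1} \bigl((a_i \vee a_{i+1}) \wedge (b_i \vee b_{i+1})\bigr) \Bigr] \wedge (b_1 \vee b_n) \Bigr). $$ A lattice is unbounded-order Arguesian if it satisfies $D_n$ for every $n\ge 3$. **Theorem.** The class of unbounded-order Arguesian lattices cannot be defined by a finite set of universal Horn sentences (in particular, not by a finite set of identities): there is no finite set $S$ of universal Horn sentences such that a lattice satisfies all members of $S$ if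 and only if it is unbounded-order Arguesian. Moreover, for every $N\ge 3$ there is a finite lattice $A_N$ in which $D_N$ fails, but in which all members of $S$ hold whenever $S$ is a finite set of universal Horn sentences that are valid in all unbounded-order Arguesian lattices and each have fewer than $N$ variables. -/

import Mathlib

universe u

/-- Formulas built from variables in `α` by the two lattice operations. (The similarity type of
lattices has no constants.) -/
inductive LatticeTerm (α : Type) : Type where
  | var : α → LatticeTerm α
  | sup : LatticeTerm α → LatticeTerm α → LatticeTerm α
  | inf : LatticeTerm α → LatticeTerm α → LatticeTerm α

/-- The value of a lattice term in `L` under the assignment `x` of values to the variables. -/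
def LatticeTerm.eval {α : Type} {L : Type*} [Lattice L] (x : α → L) : LatticeTerm α → L
  | .var i => x i
  | .sup s t => s.eval x ⊔ t.eval x
  | .inf s t => s.eval x ⊓ t.eval x

/-- A formal equation `lhs = rhs` between lattice terms in `k` variables. -/
structure LatticeEquation (k : ℕ) where
  lhs : LatticeTerm (Fin k)
  rhs : LatticeTerm (Fin k)

/-- The equation is true in `L` under the assignment `x`. -/
def LatticeEquation.HoldsAt {k : ℕ} (e : LatticeEquation k) {L : Type*} [Lattice L]
    (x : Fin k → L) : Prop :=
  e.lhs.eval x = e.rhs.eval x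

/-- A universal Horn sentence (equational implication) in the language of lattices:
`P₁ = Q₁ and … and Pₘ = Qₘ implies P = Q`, with `m ≥ 0`, universally quantified over `numVars`
variables. An identity is the case `premises = []`. -/
structure LatticeHornSentence where
  numVars : ℕ
  premises : List (LatticeEquation numVars)
  conclusion : LatticeEquation numVars

/-- The lattice `L` satisfies the universal Horn sentence `φ`. -/
def LatticeHornSentence.Holds (φ : LatticeHornSentence) (L : Type*) [Lattice L] : Prop :=
  ∀ x : Fin φ.numVars → L, (∀ e ∈ φ.premises, e.HoldsAt x) → φ.conclusion.HoldsAt x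

/-- The `n`-th order Arguesian law `D_n`. Only `a 1, …, a n` and `b 1, …, b n` occur in it.
The iterated meet and join are over `1 ≤ i ≤ n - 1`; for `n = 1`, where this range is empty,
`D_1` is the trivially true law. -/
def ArguesianLaw (n : ℕ) (L : Type*) [Lattice L] : Prop :=
  ∀ (h : (Finset.Ico 1 n).Nonempty) (a b : ℕ → L),
    a n ⊓ ((Finset.Ico 1 n).inf' h (fun i => a i ⊔ b i) ⊔ b n) ≤
      a 1 ⊔ ((Finset.Ico 1 n).sup' h (fun i => (a i ⊔ a (i + 1)) ⊓ (b i ⊔ b (i + 1))) ⊓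
        (b 1 ⊔ b n))

/-- Unbounded-order Arguesian lattices: those satisfying `D_n` for all `n ≥ 3`. -/
def UnboundedOrderArguesian (L : Type*) [Lattice L] : Prop :=
  ∀ n : ℕ, 3 ≤ n → ArguesianLaw n L

/-!
For every `m` there is a finite lattice, `TwistedLattice m`, that violates the law of order `m + 3`
while every sublattice generated by fewer than `m + 3` elements embeds into a lattice of subspaces.
Lattices of subspaces satisfy all the laws (`arguesianLaw_submodule`), so a Horn sentence in fewer
than `m + 3` variables that is valid in all unbounded-order Arguesian lattices holds in
`TwistedLattice m`. Both assertions follow.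

Let `n = m + 3`, and let `X` and `Y` be copies of `𝔽₃ ^ n`. To a subspace `W` of `X × Y` belong the
set `Cosupp W` of the `t` for which the basis vector `t` of `X` is not in `W`, and the set `Supp W`
of the `s` for which the coordinate `s` of `Y` does not vanish on `W`. For fixed `t` and `s`, the
subspaces with `(t, s) ∉ Cosupp W × Supp W` form the union of a principal filter and a principal
ideal, hence a sublattice. So for any bipartite graph, the subspaces for which `Cosupp W × Supp W`
consists of edges form a lattice; the graph used is the cycle with the edges `t — t'` and
`t — (t + 1)'`. A rectangle `Cosupp W × Supp W` is then empty, an edge, or a pair of adjacent edges.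
If it is empty, `W` contains or is contained in `X`, and is fixed by the reflection
`(x, y) ↦ (x, -y)`. Comparable elements with nonempty rectangles share an edge. The twisted order
arises by cutting the cycle at one place and regluing the elements there by the reflection.

If the elements whose rectangle contains one diagonal edge `i — i'` are left out, the cycle is
broken and the twist can be undone: reflecting the elements on one side of the gap (`chart`) turns
the twisted order into inclusion (`twistedLE_iff_chart`). As an element contains at most one of the
`n` diagonal edges, fewer than `n` elements always lie in the domain of a common chart. The case of
two elements, together with the comparison of charts, shows that the twisted order is that of a
lattice.

For the failure of the law, let `a k` and `b k` be the subspaces spanned by the basis vectors of `X`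
other than those at `k - 1` and `k` (counted cyclically from `1`) and by `β k`, respectively
`v + β k`, where `β k` is a basis vector of `Y` and `v ∈ X` is the vector with all coordinates `1`. Here every
`a k ⊔ b k` contains `v`, so the left side of the law is `a n`. The element
`(a k ⊔ a (k + 1)) ⊓ (b k ⊔ b (k + 1))` lies in the hyperplane of all `(x, y)` with `∑ y = 0`. This
hyperplane meets `b 1 ⊔ b n` in `β 1 - β n` in the untwisted lattice, which would give `β n` on the
right side of the law, but in `β 1 - β n - 2 v` after the twist (modulo vectors of `X` with last
coordinate `0`). Since `2 ≠ 0`, the right side does not contain `β n`.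
-/

/-! ### The higher Arguesian laws in submodule lattices -/

/-- Submodule lattices satisfy all the laws. If `r + s` lies on the left, with `s ∈ b n` and
`r = p i + q i` in every `a i ⊔ b i`, then `p (i + 1) - p i = q i - q (i + 1)` lies in the `i`-th
member of the join on the right, and these differences telescope. -/
theorem arguesianLaw_submodule (n : ℕ) (R M : Type*) [Ring R] [AddCommGroup M] [Module R M] :
    ArguesianLaw n (Submodule R M) := by
  intro h a b v hv
  obtain ⟨hva, hv⟩ := Submodule.mem_inf.1 hv
  obtain ⟨r, hr, s, hs, rfl⟩ := Submodule.mem_sup.1 hv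
  have hr' : ∀ i ∈ Finset.Ico 1 n, ∃ p ∈ a i, ∃ q ∈ b i, p + q = r := fun i hi =>
    Submodule.mem_sup.1 (Finset.inf'_le (fun i => a i ⊔ b i) hi hr)
  have hn : 1 < n := Finset.nonempty_Ico.1 h
  -- The decomposition `r = (r + s) + (-s)` along `a n`, `b n` completes the family at `i = n`.
  have key : ∀ i, ∃ p q : M, i ∈ Finset.Icc 1 n → p ∈ a i ∧ q ∈ b i ∧ p + q = r ∧
      (i = n → p = r + s) := by
    intro i
    by_cases hi : i ∈ Finset.Ico 1 n
    · obtain ⟨p, hp, q, hq, e⟩ := hr' i hi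
      refine ⟨p, q, fun _ => ⟨hp, hq, e, fun hin => ?_⟩⟩
      simp [hin] at hi
    · by_cases hin : i = n
      · subst hin
        exact ⟨r + s, -s, fun _ => ⟨hva, neg_mem hs, by abel, fun _ => rfl⟩⟩
      · refine ⟨0, 0, fun h' => absurd h' ?_⟩
        simp only [Finset.mem_Ico, Finset.mem_Icc] at hi ⊢
        omega
  choose p q hpq using key
  have hmem : ∀ i, 1 ≤ i → i ≤ n → p i ∈ a i ∧ q i ∈ b i ∧ p i + q i = r ∧ (i = n → p i = r + s) :=
    fun i h1 h2 => hpq i (Finset.mem_Icc.2 ⟨h1, h2⟩)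
  have tele : ∀ k, 1 ≤ k → k ≤ n → p k - p 1 ∈ (Finset.Ico 1 n).sup' h
      (fun i => (a i ⊔ a (i + 1)) ⊓ (b i ⊔ b (i + 1))) := by
    intro k hk
    induction k, hk using Nat.le_induction with
    | base => simp
    | succ k hk ih =>
      intro hkn
      obtain ⟨h1, h2, h3, -⟩ := hmem k hk (by omega)
      obtain ⟨h4, h5, h6, -⟩ := hmem (k + 1) (by omega) hkn
      have e : p (k + 1) - p 1 = (p (k + 1) - p k) + (p k - p 1) := by abel
      rw [e]
      refine add_mem ?_ (ih (by omega))
      refine Finset.le_sup' (fun i => (a i ⊔ a (i + 1)) ⊓ (b i ⊔ b (i + 1)))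
        (Finset.mem_Ico.2 ⟨hk, hkn⟩) (Submodule.mem_inf.2 ⟨?_, ?_⟩)
      · exact sub_mem (Submodule.mem_sup_right h4) (Submodule.mem_sup_left h1)
      · have e : p (k + 1) - p k = q k - q (k + 1) := by
          rw [sub_eq_sub_iff_add_eq_add, h6, add_comm, h3]
        rw [e]
        exact sub_mem (Submodule.mem_sup_left h2) (Submodule.mem_sup_right h5)
  obtain ⟨h1, h2, h3, -⟩ := hmem 1 le_rfl hn.le
  obtain ⟨-, h5, h6, h7⟩ := hmem n hn.le le_rfl
  have e : r + s = p 1 + (p n - p 1) := by rw [h7 rfl]; abel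
  rw [e]
  refine Submodule.add_mem_sup h1 (Submodule.mem_inf.2 ⟨tele n hn.le le_rfl, ?_⟩)
  have e : p n - p 1 = q 1 - q n := by
    rw [sub_eq_sub_iff_add_eq_add, h6, add_comm, h3]
  rw [e]
  exact sub_mem (Submodule.mem_sup_left h2) (Submodule.mem_sup_right h5)

theorem ArguesianLaw.of_injective {n : ℕ} {L M : Type*} [Lattice L] [Lattice M]
    (f : LatticeHom L M) (hf : Function.Injective f) (hM : ArguesianLaw n M) :
    ArguesianLaw n L := by
  intro h a b
  have := hM h (fun i => f (a i)) (fun i => f (b i))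
  rw [← inf_eq_left] at this ⊢
  apply hf
  simpa only [map_inf, map_sup, map_finset_inf', map_finset_sup', Function.comp_def] using this

/-! ### Horn sentences and sublattices -/

theorem LatticeTerm.map_eval {α : Type} {L M : Type*} [Lattice L] [Lattice M]
    (f : LatticeHom L M) (x : α → L) (t : LatticeTerm α) :
    f (t.eval x) = t.eval (fun i => f (x i)) := by
  induction t with
  | var i => rfl
  | sup s t hs ht => simp only [LatticeTerm.eval, map_sup, hs, ht]
  | inf s t hs ht => simp only [LatticeTerm.eval, map_inf, hs, ht]

/-- A Horn sentence holds in a lattice as soon as every evaluation of its variables takes place in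
a sublattice that satisfies it. -/
theorem LatticeHornSentence.holds_of_sublattice {φ : LatticeHornSentence} {L : Type*} [Lattice L]
    (h : ∀ x : Fin φ.numVars → L, ∃ G : Sublattice L, (∀ i, x i ∈ G) ∧ φ.Holds G) :
    φ.Holds L := by
  intro x hx
  obtain ⟨G, hxG, hG⟩ := h x
  have ev : ∀ t : LatticeTerm (Fin φ.numVars),
      (t.eval (fun i => (⟨x i, hxG i⟩ : G)) : G).1 = t.eval x := fun t =>
    LatticeTerm.map_eval G.subtype _ t
  have := hG (fun i => ⟨x i, hxG i⟩) fun e he => Subtype.ext <| by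
    rw [ev, ev]; exact hx e he
  have := congrArg Subtype.val this
  rwa [ev, ev] at this

/-! ### Supports and cosupports of subspaces of `K ^ n × K ^ n` -/

/-- The ambient space `X × Y` with `X = Y = 𝔽₃ ^ (m + 3)`. -/
abbrev DoubleSpace (m : ℕ) : Type := (Fin (m + 3) → ZMod 3) × (Fin (m + 3) → ZMod 3)

/-- Subspaces of `X × Y`. -/
abbrev DoubleSubspace (m : ℕ) : Type := Submodule (ZMod 3) (DoubleSpace m)

namespace DoubleSubspace

variable {m : ℕ} {W W' : DoubleSubspace m} {i j s t : Fin (m + 3)}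

/-- The `t`-th basis vector of the factor `X` does not lie in `W`. The set of these `t` is empty
exactly if `X ≤ W`. -/
def Cosupp (W : DoubleSubspace m) (t : Fin (m + 3)) : Prop :=
  ((Pi.single t 1, 0) : DoubleSpace m) ∉ W

/-- The `s`-th coordinate on the factor `Y` does not vanish on `W`. The set of these `s` is empty
exactly if `W ≤ X`. -/
def Supp (W : DoubleSubspace m) (s : Fin (m + 3)) : Prop :=
  ∃ w ∈ W, w.2 s ≠ 0

theorem Cosupp.anti (h : W ≤ W') (ht : W'.Cosupp t) : W.Cosupp t := fun h' => ht (h h')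

theorem Supp.mono (h : W ≤ W') (hs : W.Supp s) : W'.Supp s :=
  let ⟨w, hw, hw'⟩ := hs; ⟨w, h hw, hw'⟩

theorem mk_zero_mem (h : ∀ t, ¬ W.Cosupp t) (x : Fin (m + 3) → ZMod 3) :
    ((x, 0) : DoubleSpace m) ∈ W := by
  have e : ((x, 0) : DoubleSpace m) = ∑ t, x t • ((Pi.single t 1, 0) : DoubleSpace m) := by
    refine Prod.ext ?_ ?_
    · rw [Prod.fst_sum]
      exact pi_eq_sum_univ' x
    · rw [Prod.snd_sum]
      simp
  rw [e]
  exact sum_mem fun t _ => W.smul_mem _ (not_not.1 (h t))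

/-- The reflection of a subspace under `(x, y) ↦ (x, -y)`. -/
def reflect (W : DoubleSubspace m) : DoubleSubspace m :=
  W.comap (LinearMap.prodMap LinearMap.id (-LinearMap.id))

theorem mem_reflect {w : DoubleSpace m} : w ∈ W.reflect ↔ (w.1, -w.2) ∈ W := Iff.rfl

theorem reflect_reflect (W : DoubleSubspace m) : W.reflect.reflect = W := by
  ext w
  simp [mem_reflect]

theorem reflect_mono (h : W ≤ W') : W.reflect ≤ W'.reflect := fun _ hw => h hw

theorem reflect_le_reflect : W.reflect ≤ W'.reflect ↔ W ≤ W' :=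
  ⟨fun h => by simpa only [reflect_reflect] using reflect_mono h, reflect_mono⟩

theorem cosupp_reflect : W.reflect.Cosupp t ↔ W.Cosupp t := by
  simp [Cosupp, mem_reflect]

theorem supp_reflect : W.reflect.Supp s ↔ W.Supp s := by
  constructor
  · rintro ⟨w, hw, hs⟩
    exact ⟨_, hw, by simpa using hs⟩
  · rintro ⟨w, hw, hs⟩
    exact ⟨(w.1, -w.2), by simpa [mem_reflect] using hw, by simpa using hs⟩

theorem reflect_eq_of_cosupp (h : ∀ t, ¬ W.Cosupp t) : W.reflect = W := by
  have key : ∀ W : DoubleSubspace m, (∀ t, ¬ W.Cosupp t) → W.reflect ≤ W := by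
    intro W h w hw
    have e : w = (w.1 + w.1, 0) - (w.1, -w.2) := by ext <;> simp
    rw [e]
    exact sub_mem (mk_zero_mem h _) hw
  refine le_antisymm (key W h) ?_
  rw [← reflect_le_reflect, reflect_reflect]
  exact key W h

theorem reflect_eq_of_supp (h : ∀ s, ¬ W.Supp s) : W.reflect = W := by
  have key : ∀ W : DoubleSubspace m, (∀ s, ¬ W.Supp s) → W ≤ W.reflect := by
    intro W h w hw
    have e : w.2 = 0 := funext fun s => by
      by_contra hs
      exact h s ⟨w, hw, hs⟩
    rw [mem_reflect, e, neg_zero, ← e]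
    exact hw
  refine le_antisymm ?_ (key W h)
  rw [← reflect_le_reflect, reflect_reflect]
  exact key W h

/-- `W` contains the `t`-th basis vector of `X`, or the `s`-th coordinate on `Y` vanishes on `W`.
The subspaces with this property are the union of a principal filter and a principal ideal. -/
def Avoids (W : DoubleSubspace m) (t s : Fin (m + 3)) : Prop := W.Cosupp t → ¬ W.Supp s

theorem Avoids.sup (h : W.Avoids t s) (h' : W'.Avoids t s) : (W ⊔ W').Avoids t s := by
  rintro ht ⟨w, hw, hs⟩
  obtain ⟨u, hu, v, hv, rfl⟩ := Submodule.mem_sup.1 hw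
  have h1 : u.2 s = 0 := by
    by_contra h1
    exact h (ht.anti le_sup_left) ⟨u, hu, h1⟩
  have h2 : v.2 s = 0 := by
    by_contra h1
    exact h' (ht.anti le_sup_right) ⟨v, hv, h1⟩
  simp [h1, h2] at hs

theorem Avoids.inf (h : W.Avoids t s) (h' : W'.Avoids t s) : (W ⊓ W').Avoids t s := by
  intro ht hs
  have h1 : ¬ W.Cosupp t := fun h1 => h h1 (hs.mono inf_le_left)
  have h2 : ¬ W'.Cosupp t := fun h1 => h' h1 (hs.mono inf_le_right)
  exact ht ⟨not_not.1 h1, not_not.1 h2⟩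

/-- The edges of the cycle `0 — 0' — 1 — 1' — … — 0` of length `2 (m + 3)`, where `t` and `s'` are
joined if `s = t` or `s` is the cyclic successor of `t`. -/
def Edge (t s : Fin (m + 3)) : Prop :=
  (s : ℕ) = t ∨ (s : ℕ) = t + 1 ∨ ((s : ℕ) = 0 ∧ (t : ℕ) = m + 2)

/-- All pairs in `Cosupp W × Supp W` are edges of the cycle. -/
def IsCyclic (W : DoubleSubspace m) : Prop := ∀ ⦃t s⦄, W.Cosupp t → W.Supp s → Edge t s

theorem isCyclic_iff : W.IsCyclic ↔ ∀ t s, ¬ Edge t s → W.Avoids t s :=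
  ⟨fun h _ _ he ht hs => he (h ht hs), fun h t s ht hs => by_contra fun he => h t s he ht hs⟩

theorem IsCyclic.sup (h : W.IsCyclic) (h' : W'.IsCyclic) : (W ⊔ W').IsCyclic :=
  isCyclic_iff.2 fun t s he => (isCyclic_iff.1 h t s he).sup (isCyclic_iff.1 h' t s he)

theorem IsCyclic.inf (h : W.IsCyclic) (h' : W'.IsCyclic) : (W ⊓ W').IsCyclic :=
  isCyclic_iff.2 fun t s he => (isCyclic_iff.1 h t s he).inf (isCyclic_iff.1 h' t s he)

/-- `Cosupp W × Supp W` contains at most one diagonal edge. -/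
theorem IsCyclic.avoids_of_ne (h : W.IsCyclic) (hi : ¬ W.Avoids i i) (hij : i ≠ j) :
    W.Avoids j j := by
  intro h1 h2
  simp only [Avoids, not_forall, not_not] at hi
  obtain ⟨h3, h4⟩ := hi
  have h5 := h h1 h4
  have h6 := h h3 h2
  simp only [Edge, ← Fin.val_ne_iff] at *
  omega

/-! ### The twisted order and its charts -/

/-- The pairs of subspaces that are compared after a reflection: their rectangles
`Cosupp × Supp` meet at the vertex `0'` of the cycle, that of the first containing the edge `0 — 0'`
and that of the second only the other edge at `0'`. -/
def Crossing (W W' : DoubleSubspace m) : Prop :=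
  W.Cosupp 0 ∧ W.Supp 0 ∧ W'.Cosupp (Fin.last (m + 2)) ∧ W'.Supp 0 ∧ ¬ W'.Cosupp 0

open Classical in
/-- The twisted order. -/
def TwistedLE (W W' : DoubleSubspace m) : Prop :=
  if Crossing W W' then W.reflect ≤ W' else W ≤ W'

theorem TwistedLE.cosupp (h : TwistedLE W W') (ht : W'.Cosupp t) : W.Cosupp t := by
  unfold TwistedLE at h
  split_ifs at h
  · exact cosupp_reflect.1 (ht.anti h)
  · exact ht.anti h

theorem TwistedLE.supp (h : TwistedLE W W') (hs : W.Supp s) : W'.Supp s := by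
  unfold TwistedLE at h
  split_ifs at h
  · exact (supp_reflect.2 hs).mono h
  · exact hs.mono h

open Classical in
/-- The chart at `i` reflects the subspaces whose rectangle contains an edge `a — b'` with `a < i`;
on subspaces with empty rectangle the reflection has no effect. It is used for the subspaces
avoiding the diagonal edge `i — i'`. -/
noncomputable def chart (i : Fin (m + 3)) (W : DoubleSubspace m) : DoubleSubspace m :=
  if ∃ a < i, W.Cosupp a then W.reflect else W

theorem cosupp_chart : (chart i W).Cosupp t ↔ W.Cosupp t := by
  unfold chart
  split_ifs
  · exact cosupp_reflect
  · rfl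

theorem supp_chart : (chart i W).Supp t ↔ W.Supp t := by
  unfold chart
  split_ifs
  · exact supp_reflect
  · rfl

theorem chart_chart (W : DoubleSubspace m) : chart i (chart i W) = W := by
  by_cases h : ∃ a < i, W.Cosupp a
  · have h' : ∃ a < i, W.reflect.Cosupp a := by simpa only [cosupp_reflect] using h
    rw [chart, chart, if_pos h, if_pos h', reflect_reflect]
  · rw [chart, chart, if_neg h, if_neg h]

theorem Avoids.chart (h : W.Avoids t s) : (chart i W).Avoids t s := by
  simpa only [Avoids, cosupp_chart, supp_chart] using h

theorem IsCyclic.chart (h : W.IsCyclic) : (chart i W).IsCyclic :=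
  isCyclic_iff.2 fun t s he => (isCyclic_iff.1 h t s he).chart

/-- Away from a diagonal edge, the twist can be undone: the chart there turns the twisted order
into inclusion. -/
theorem twistedLE_iff_chart (h : W.IsCyclic) (h' : W'.IsCyclic) (hi : W.Avoids i i)
    (hi' : W'.Avoids i i) : TwistedLE W W' ↔ chart i W ≤ chart i W' := by
  by_cases hS : ∃ b, W.Supp b
  swap
  · -- `W ≤ X` is fixed by the reflection
    push Not at hS
    have e := reflect_eq_of_supp hS
    have e1 : W ≤ W'.reflect ↔ W ≤ W' := by rw [← reflect_le_reflect, reflect_reflect, e]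
    unfold TwistedLE chart
    split_ifs <;> simp only [e, e1]
  by_cases hT : ∃ a, W'.Cosupp a
  swap
  · -- `X ≤ W'` is fixed by the reflection
    push Not at hT
    have e := reflect_eq_of_cosupp hT
    have e1 : W.reflect ≤ W' ↔ W ≤ W' := by rw [← reflect_le_reflect, reflect_reflect, e]
    unfold TwistedLE chart
    split_ifs <;> simp only [e, e1]
  obtain ⟨b, hb⟩ := hS
  obtain ⟨a, ha⟩ := hT
  by_cases hsub : (∀ t, W'.Cosupp t → W.Cosupp t) ∧ (∀ s, W.Supp s → W'.Supp s)
  swap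
  · refine iff_of_false (fun h0 => hsub ⟨fun t => h0.cosupp, fun s => h0.supp⟩) fun h0 => hsub
      ⟨fun t ht => ?_, fun s hs => ?_⟩
    · exact cosupp_chart.1 ((cosupp_chart.2 ht).anti h0)
    · exact supp_chart.1 ((supp_chart.2 hs).mono h0)
  obtain ⟨hT, hS⟩ := hsub
  -- Both rectangles contain the edge `a — b'`; only the crossing pairs are treated differently
  -- by the chart.
  have hcross : Crossing W W' ↔ (∃ t < i, W.Cosupp t) ∧ ¬ ∃ t < i, W'.Cosupp t := by
    constructor
    · rintro ⟨h1, h2, h3, h4, h5⟩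
      have hi0 : i ≠ 0 := by rintro rfl; exact hi h1 h2
      refine ⟨⟨0, Fin.pos_iff_ne_zero.2 hi0, h1⟩, ?_⟩
      rintro ⟨t, ht, ht'⟩
      have ht0 : t ≠ 0 := by rintro rfl; exact h5 ht'
      have := h' ht' h4
      have := i.isLt
      simp only [Edge, Fin.lt_def, ← Fin.val_ne_iff, Fin.val_zero] at *
      omega
    · rintro ⟨⟨t, ht, ht'⟩, hn⟩
      have hai : ¬ a < i := fun hai => hn ⟨a, hai, ha⟩
      have e1 := h ht' hb
      have e2 := h' ha (hS b hb)
      have hne : ¬ ((a : ℕ) = i ∧ (b : ℕ) = i) := by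
        rintro ⟨h1, h2⟩
        obtain rfl := Fin.ext h1
        obtain rfl := Fin.ext h2
        exact hi' ha (hS _ hb)
      have hb0 : b = 0 ∧ a = Fin.last (m + 2) ∧ t = 0 := by
        simp only [Edge, Fin.lt_def, Fin.ext_iff, Fin.val_zero, Fin.val_last] at *
        omega
      obtain ⟨rfl, rfl, rfl⟩ := hb0
      exact ⟨ht', hb, ha, hS 0 hb, fun h0 => hn ⟨0, ht, h0⟩⟩
  have himp : (∃ t < i, W'.Cosupp t) → ∃ t < i, W.Cosupp t := fun ⟨t, h1, h2⟩ => ⟨t, h1, hT t h2⟩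
  unfold TwistedLE chart
  by_cases h1 : ∃ t < i, W.Cosupp t <;> by_cases h2 : ∃ t < i, W'.Cosupp t
  · rw [if_neg fun h0 => (hcross.1 h0).2 h2, if_pos h1, if_pos h2, reflect_le_reflect]
  · rw [if_pos (hcross.2 ⟨h1, h2⟩), if_pos h1, if_neg h2]
  · exact absurd (himp h2) h1
  · rw [if_neg fun h0 => h1 (hcross.1 h0).1, if_neg h1, if_neg h2]

/-- Three cyclic subspaces avoid a common diagonal edge, unless they contain three different ones:
there are at least three diagonal edges, and each subspace contains at most one. -/
theorem exists_avoids_of_three {W₁ W₂ W₃ : DoubleSubspace m} (h₁ : W₁.IsCyclic)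
    (h₂ : W₂.IsCyclic) (h₃ : W₃.IsCyclic)
    (h : ∀ i j k, ¬ W₁.Avoids i i → ¬ W₂.Avoids j j → ¬ W₃.Avoids k k →
      i = j ∨ j = k ∨ i = k) :
    ∃ i, W₁.Avoids i i ∧ W₂.Avoids i i ∧ W₃.Avoids i i := by
  have hd : ∀ W : DoubleSubspace m, W.IsCyclic → ∃ k, (∀ i, i ≠ k → W.Avoids i i) := by
    intro W hW
    by_cases hk : ∃ k, ¬ W.Avoids k k
    · obtain ⟨k, hk⟩ := hk
      exact ⟨k, fun i hi => hW.avoids_of_ne hk hi.symm⟩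
    · push Not at hk
      exact ⟨0, fun i _ => hk i⟩
  obtain ⟨k₁, hk₁⟩ := hd W₁ h₁
  obtain ⟨k₂, hk₂⟩ := hd W₂ h₂
  obtain ⟨k₃, hk₃⟩ := hd W₃ h₃
  have two : ∀ p q : Fin (m + 3), ∃ r, r ≠ p ∧ r ≠ q := by
    intro p q
    obtain ⟨r, -, hr⟩ := Finset.exists_mem_notMem_of_card_lt_card
      (s := {p, q}) (t := (Finset.univ : Finset (Fin (m + 3))))
      (Finset.card_le_two.trans_lt (by simp))
    exact ⟨r, by simpa using hr⟩
  have all : ∀ {W : DoubleSubspace m} {k}, (∀ i, i ≠ k → W.Avoids i i) → W.Avoids k k →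
      ∀ i, W.Avoids i i := fun {W k} h h' i => by
    by_cases hik : i = k
    · exact hik ▸ h'
    · exact h i hik
  by_cases a₁ : W₁.Avoids k₁ k₁
  · obtain ⟨r, h2, h3⟩ := two k₂ k₃
    exact ⟨r, all hk₁ a₁ r, hk₂ r h2, hk₃ r h3⟩
  by_cases a₂ : W₂.Avoids k₂ k₂
  · obtain ⟨r, h1, h3⟩ := two k₁ k₃
    exact ⟨r, hk₁ r h1, all hk₂ a₂ r, hk₃ r h3⟩
  by_cases a₃ : W₃.Avoids k₃ k₃
  · obtain ⟨r, h1, h2⟩ := two k₁ k₂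
    exact ⟨r, hk₁ r h1, hk₂ r h2, all hk₃ a₃ r⟩
  obtain rfl | rfl | rfl := h k₁ k₂ k₃ a₁ a₂ a₃
  · obtain ⟨r, h1, h3⟩ := two k₁ k₃
    exact ⟨r, hk₁ r h1, hk₂ r h1, hk₃ r h3⟩
  · obtain ⟨r, h1, h2⟩ := two k₁ k₂
    exact ⟨r, hk₁ r h1, hk₂ r h2, hk₃ r h2⟩
  · obtain ⟨r, h1, h2⟩ := two k₁ k₂
    exact ⟨r, hk₁ r h1, hk₂ r h2, hk₃ r h1⟩

end DoubleSubspace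

/-! ### The twisted lattice -/

open DoubleSubspace

/-- The cyclic subspaces with the twisted order. They are placed in an arbitrary universe. -/
@[ext]
structure TwistedLattice (m : ℕ) : Type u where
  carrier : DoubleSubspace m
  isCyclic : carrier.IsCyclic

namespace TwistedLattice

variable {m : ℕ} {x y z w : TwistedLattice.{u} m} {i : Fin (m + 3)}

/-- The elements not containing the diagonal edge `i — i'`. -/
def Avoids (x : TwistedLattice.{u} m) (i : Fin (m + 3)) : Prop := x.carrier.Avoids i i

instance : LE (TwistedLattice.{u} m) := ⟨fun x y => TwistedLE x.carrier y.carrier⟩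

theorem le_iff_chart (hx : x.Avoids i) (hy : y.Avoids i) :
    x ≤ y ↔ chart i x.carrier ≤ chart i y.carrier :=
  twistedLE_iff_chart x.isCyclic y.isCyclic hx hy

theorem exists_avoids (x y : TwistedLattice.{u} m) : ∃ i, x.Avoids i ∧ y.Avoids i := by
  obtain ⟨i, h1, h2, -⟩ := exists_avoids_of_three x.isCyclic y.isCyclic y.isCyclic
    fun i j k _ hj hk => Or.inr <| Or.inl <| by
      by_contra h
      exact hk (y.isCyclic.avoids_of_ne hj h)
  exact ⟨i, h1, h2⟩

theorem exists_avoids_of_le_of_le (hxy : x ≤ y) (hyz : y ≤ z) :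
    ∃ i, x.Avoids i ∧ y.Avoids i ∧ z.Avoids i := by
  refine exists_avoids_of_three x.isCyclic y.isCyclic z.isCyclic fun i j k hi hj hk => ?_
  simp only [DoubleSubspace.Avoids, not_forall, not_not] at hi hj hk
  obtain ⟨-, hi⟩ := hi
  obtain ⟨hj, hj'⟩ := hj
  obtain ⟨hk, -⟩ := hk
  have h1 := y.isCyclic hj (TwistedLE.supp hxy hi)
  have h2 := y.isCyclic (TwistedLE.cosupp hyz hk) hj'
  have h3 := y.isCyclic (TwistedLE.cosupp hyz hk) (TwistedLE.supp hxy hi)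
  simp only [Edge, Fin.ext_iff] at *
  omega

theorem exists_avoids_of_upper (hx : x ≤ z) (hy : y ≤ z) :
    ∃ i, x.Avoids i ∧ y.Avoids i ∧ z.Avoids i := by
  refine exists_avoids_of_three x.isCyclic y.isCyclic z.isCyclic fun i j k hi hj hk => ?_
  simp only [DoubleSubspace.Avoids, not_forall, not_not] at hi hj hk
  obtain ⟨-, hi⟩ := hi
  obtain ⟨-, hj⟩ := hj
  obtain ⟨hk, -⟩ := hk
  have h1 := z.isCyclic hk (TwistedLE.supp hx hi)
  have h2 := z.isCyclic hk (TwistedLE.supp hy hj)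
  simp only [Edge, Fin.ext_iff] at *
  omega

theorem exists_avoids_of_lower (hx : z ≤ x) (hy : z ≤ y) :
    ∃ i, x.Avoids i ∧ y.Avoids i ∧ z.Avoids i := by
  refine exists_avoids_of_three x.isCyclic y.isCyclic z.isCyclic fun i j k hi hj hk => ?_
  simp only [DoubleSubspace.Avoids, not_forall, not_not] at hi hj hk
  obtain ⟨hi, -⟩ := hi
  obtain ⟨hj, -⟩ := hj
  obtain ⟨-, hk⟩ := hk
  have h1 := z.isCyclic (TwistedLE.cosupp hx hi) hk
  have h2 := z.isCyclic (TwistedLE.cosupp hy hj) hk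
  simp only [Edge, Fin.ext_iff] at *
  omega

instance : PartialOrder (TwistedLattice.{u} m) where
  le_refl x := by
    obtain ⟨i, hi, -⟩ := exists_avoids x x
    exact (le_iff_chart hi hi).2 le_rfl
  le_trans x y z hxy hyz := by
    obtain ⟨i, hx, hy, hz⟩ := exists_avoids_of_le_of_le hxy hyz
    exact (le_iff_chart hx hz).2
      (((le_iff_chart hx hy).1 hxy).trans ((le_iff_chart hy hz).1 hyz))
  le_antisymm x y hxy hyx := by
    obtain ⟨i, hx, hy⟩ := exists_avoids x y
    have := le_antisymm ((le_iff_chart hx hy).1 hxy) ((le_iff_chart hy hx).1 hyx)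
    ext1
    rw [← chart_chart (i := i) x.carrier, this, chart_chart]

/-- The element whose image in the chart at `i` is the sum of the images of `x` and `y`. -/
noncomputable def chartSup (i : Fin (m + 3)) (x y : TwistedLattice.{u} m) :
    TwistedLattice.{u} m where
  carrier := chart i (chart i x.carrier ⊔ chart i y.carrier)
  isCyclic := (x.isCyclic.chart.sup y.isCyclic.chart).chart

/-- The element whose image in the chart at `i` is the intersection of the images of `x`
and `y`. -/
noncomputable def chartInf (i : Fin (m + 3)) (x y : TwistedLattice.{u} m) :
    TwistedLattice.{u} m where
  carrier := chart i (chart i x.carrier ⊓ chart i y.carrier)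
  isCyclic := (x.isCyclic.chart.inf y.isCyclic.chart).chart

theorem Avoids.chartSup {j : Fin (m + 3)} (hx : x.Avoids i) (hy : y.Avoids i) :
    (chartSup j x y).Avoids i :=
  (DoubleSubspace.Avoids.sup (DoubleSubspace.Avoids.chart hx)
    (DoubleSubspace.Avoids.chart hy)).chart

theorem Avoids.chartInf {j : Fin (m + 3)} (hx : x.Avoids i) (hy : y.Avoids i) :
    (chartInf j x y).Avoids i :=
  (DoubleSubspace.Avoids.inf (DoubleSubspace.Avoids.chart hx)
    (DoubleSubspace.Avoids.chart hy)).chart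

theorem chartSup_le_iff (hx : x.Avoids i) (hy : y.Avoids i) (hz : z.Avoids i) :
    chartSup i x y ≤ z ↔ x ≤ z ∧ y ≤ z := by
  rw [le_iff_chart (hx.chartSup hy) hz, le_iff_chart hx hz, le_iff_chart hy hz, chartSup,
    chart_chart, sup_le_iff]

theorem le_chartInf_iff (hx : x.Avoids i) (hy : y.Avoids i) (hz : z.Avoids i) :
    z ≤ chartInf i x y ↔ z ≤ x ∧ z ≤ y := by
  rw [le_iff_chart hz (hx.chartInf hy), le_iff_chart hz hx, le_iff_chart hz hy, chartInf,
    chart_chart, le_inf_iff]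

/-- Suprema can be computed in any chart defined at both elements. An upper bound `w` outside the
chart is compared through the supremum formed in another chart, one that contains `w`. -/
theorem isLUB_chartSup (hx : x.Avoids i) (hy : y.Avoids i) : IsLUB {x, y} (chartSup i x y) := by
  have h := (chartSup_le_iff hx hy (hx.chartSup hy)).1 le_rfl
  refine ⟨by simpa [upperBounds] using h, fun w hw => ?_⟩
  obtain ⟨hxw, hyw⟩ : x ≤ w ∧ y ≤ w := by simpa [upperBounds] using hw
  obtain ⟨j, hxj, hyj, hwj⟩ := exists_avoids_of_upper hxw hyw
  refine le_trans ?_ ((chartSup_le_iff hxj hyj hwj).2 ⟨hxw, hyw⟩)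
  exact (chartSup_le_iff hx hy (hx.chartSup hy)).2
    ((chartSup_le_iff hxj hyj (hxj.chartSup hyj)).1 le_rfl)

theorem isGLB_chartInf (hx : x.Avoids i) (hy : y.Avoids i) : IsGLB {x, y} (chartInf i x y) := by
  have h := (le_chartInf_iff hx hy (hx.chartInf hy)).1 le_rfl
  refine ⟨by simpa [lowerBounds] using h, fun w hw => ?_⟩
  obtain ⟨hxw, hyw⟩ : w ≤ x ∧ w ≤ y := by simpa [lowerBounds] using hw
  obtain ⟨j, hxj, hyj, hwj⟩ := exists_avoids_of_lower hxw hyw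
  refine ((le_chartInf_iff hxj hyj hwj).2 ⟨hxw, hyw⟩).trans ?_
  exact (le_chartInf_iff hx hy (hx.chartInf hy)).2
    ((le_chartInf_iff hxj hyj (hxj.chartInf hyj)).1 le_rfl)

noncomputable instance : Lattice (TwistedLattice.{u} m) where
  sup x y := chartSup (exists_avoids x y).choose x y
  inf x y := chartInf (exists_avoids x y).choose x y
  le_sup_left x y := (isLUB_chartSup (exists_avoids x y).choose_spec.1
    (exists_avoids x y).choose_spec.2).1 (by simp)
  le_sup_right x y := (isLUB_chartSup (exists_avoids x y).choose_spec.1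
    (exists_avoids x y).choose_spec.2).1 (by simp)
  sup_le x y z hx hy := (isLUB_chartSup (exists_avoids x y).choose_spec.1
    (exists_avoids x y).choose_spec.2).2 (by simp [upperBounds, hx, hy])
  inf_le_left x y := (isGLB_chartInf (exists_avoids x y).choose_spec.1
    (exists_avoids x y).choose_spec.2).1 (by simp)
  inf_le_right x y := (isGLB_chartInf (exists_avoids x y).choose_spec.1
    (exists_avoids x y).choose_spec.2).1 (by simp)
  le_inf z x y hx hy := (isGLB_chartInf (exists_avoids x y).choose_spec.1
    (exists_avoids x y).choose_spec.2).2 (by simp [lowerBounds, hx, hy])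

theorem sup_eq_chartSup (hx : x.Avoids i) (hy : y.Avoids i) : x ⊔ y = chartSup i x y :=
  isLUB_pair.unique (isLUB_chartSup hx hy)

theorem inf_eq_chartInf (hx : x.Avoids i) (hy : y.Avoids i) : x ⊓ y = chartInf i x y :=
  isGLB_pair.unique (isGLB_chartInf hx hy)

instance : Finite (TwistedLattice.{u} m) :=
  Finite.of_injective TwistedLattice.carrier fun _ _ => TwistedLattice.ext

/-- The sublattice of the elements not containing the diagonal edge `i — i'`. -/
def avoiding (i : Fin (m + 3)) : Sublattice (TwistedLattice.{u} m) where
  carrier := {x | x.Avoids i}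
  supClosed' x hx y hy := by
    rw [sup_eq_chartSup hx hy]; exact hx.chartSup hy
  infClosed' x hx y hy := by
    rw [inf_eq_chartInf hx hy]; exact hx.chartInf hy

/-- The chart at `i` as a homomorphism into the lattice of all subspaces. -/
noncomputable def chartHom (i : Fin (m + 3)) :
    LatticeHom (avoiding.{u} i) (DoubleSubspace m) where
  toFun x := chart i x.1.carrier
  map_sup' x y := by
    rw [Sublattice.coe_sup, sup_eq_chartSup x.2 y.2, chartSup, chart_chart]
  map_inf' x y := by
    rw [Sublattice.coe_inf, inf_eq_chartInf x.2 y.2, chartInf, chart_chart]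

theorem chartHom_injective (i : Fin (m + 3)) :
    Function.Injective (chartHom.{u} i) := fun x y h => by
  have h : chart i x.1.carrier = chart i y.1.carrier := h
  ext1; ext1
  rw [← chart_chart (i := i) x.1.carrier, h, chart_chart]

theorem unboundedOrderArguesian_avoiding (i : Fin (m + 3)) :
    UnboundedOrderArguesian (avoiding.{u} i) := fun n _ =>
  .of_injective (chartHom i) (chartHom_injective i) (arguesianLaw_submodule n _ _)

/-- Fewer than `m + 3` elements avoid a common diagonal edge. -/
theorem exists_forall_avoids {k : ℕ} (hk : k < m + 3) (x : Fin k → TwistedLattice.{u} m) :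
    ∃ i, ∀ l, (x l).Avoids i := by
  by_contra! h
  choose l hl using h
  obtain ⟨i, j, hij, e⟩ := Fintype.exists_ne_map_eq_of_card_lt l (by simpa using hk)
  exact hl j (e ▸ (x (l i)).isCyclic.avoids_of_ne (hl i) hij)

/-- Sentences in fewer than `m + 3` variables are tested inside the sublattices `avoiding i`. -/
theorem holds_of_numVars_lt {φ : LatticeHornSentence} (hφ : φ.numVars < m + 3)
    (h : ∀ (L : Type u) [Lattice L], UnboundedOrderArguesian L → φ.Holds L) :
    φ.Holds (TwistedLattice.{u} m) := by
  refine LatticeHornSentence.holds_of_sublattice fun x => ?_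
  obtain ⟨i, hi⟩ := exists_forall_avoids hφ x
  exact ⟨avoiding i, hi, h _ (unboundedOrderArguesian_avoiding i)⟩

end TwistedLattice

/-! ### Failure of the Arguesian law -/

namespace DoubleSubspace

variable {m : ℕ}

/-- The pairs `(x, y)` such that `y` is supported in `P` and all coordinates of `x` in `Q` are equal
to `c y`. -/
def graphOn (P Q : Fin (m + 3) → Prop) (c : (Fin (m + 3) → ZMod 3) →ₗ[ZMod 3] ZMod 3) :
    DoubleSubspace m where
  carrier := {w | (∀ k, ¬ P k → w.2 k = 0) ∧ ∀ k, Q k → w.1 k = c w.2}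
  add_mem' := fun {v w} hv hw => by
    refine ⟨fun k hk => ?_, fun k hk => ?_⟩
    · simp [hv.1 k hk, hw.1 k hk]
    · simp [hv.2 k hk, hw.2 k hk]
  zero_mem' := by simp
  smul_mem' := fun r w hw => by
    refine ⟨fun k hk => ?_, fun k hk => ?_⟩
    · simp [hw.1 k hk]
    · simp [hw.2 k hk]

variable {P Q : Fin (m + 3) → Prop} {c : (Fin (m + 3) → ZMod 3) →ₗ[ZMod 3] ZMod 3}
  {w : DoubleSpace m} {s t : Fin (m + 3)}

theorem mem_graphOn :
    w ∈ graphOn P Q c ↔ (∀ k, ¬ P k → w.2 k = 0) ∧ ∀ k, Q k → w.1 k = c w.2 := Iff.rfl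

theorem supp_graphOn : (graphOn P Q c).Supp s ↔ P s := by
  constructor
  · rintro ⟨w, hw, hs⟩
    by_contra hP
    exact hs (hw.1 s hP)
  · refine fun hP => ⟨(fun _ => c (Pi.single s 1), Pi.single s 1),
      ⟨fun k hk => ?_, fun k _ => rfl⟩, by simp⟩
    have : k ≠ s := by rintro rfl; exact hk hP
    simp [this]

theorem cosupp_graphOn : (graphOn P Q c).Cosupp t ↔ Q t := by
  constructor
  · intro h
    by_contra hQ
    refine h ⟨fun k _ => rfl, fun k hk => ?_⟩
    have : k ≠ t := by rintro rfl; exact hQ hk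
    simp [this]
  · intro hQ h
    have := h.2 t hQ
    simp at this

theorem isCyclic_graphOn (h : ∀ t s, Q t → P s → Edge t s) : (graphOn P Q c).IsCyclic :=
  fun t s ht hs => h t s (cosupp_graphOn.1 ht) (supp_graphOn.1 hs)

/-- The sum of the coordinates. -/
def coordSum (m : ℕ) : (Fin (m + 3) → ZMod 3) →ₗ[ZMod 3] ZMod 3 := ∑ k, LinearMap.proj k

theorem coordSum_apply (y : Fin (m + 3) → ZMod 3) : coordSum m y = ∑ k, y k := by
  simp [coordSum]

/-- The hyperplane of all pairs `(x, y)` for which the coordinates of `y` add up to `0`. -/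
def sumZero (m : ℕ) : DoubleSubspace m where
  carrier := {w | ∑ k, w.2 k = 0}
  add_mem' := fun {v w} (hv : _ = _) (hw : _ = _) => by
    simp [Finset.sum_add_distrib, hv, hw]
  zero_mem' := by simp
  smul_mem' := fun r w (hw : _ = _) => by
    simp [← Finset.mul_sum, hw]

theorem not_cosupp_sumZero : ¬ (sumZero m).Cosupp t := by
  intro h
  exact h (by simp [sumZero])

/-- The line in `X` spanned by the vector all of whose coordinates are `1`. -/
def diagonalLine (m : ℕ) : DoubleSubspace m where
  carrier := {w | w.2 = 0 ∧ ∀ j k, w.1 j = w.1 k}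
  add_mem' := fun {v w} hv hw =>
    ⟨by simp [hv.1, hw.1], fun j k => by simp [hv.2 j k, hw.2 j k]⟩
  zero_mem' := by simp
  smul_mem' := fun r w hw =>
    ⟨by simp [hw.1], fun j k => by simp [hw.2 j k]⟩

theorem not_supp_diagonalLine : ¬ (diagonalLine m).Supp s := by
  rintro ⟨w, hw, h⟩
  exact h (by rw [hw.1]; rfl)

end DoubleSubspace

namespace TwistedLattice

variable {m : ℕ} {x y : TwistedLattice.{u} m}

theorem le_iff_of_not_crossing (h : ¬ Crossing x.carrier y.carrier) :
    x ≤ y ↔ x.carrier ≤ y.carrier := by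
  change TwistedLE _ _ ↔ _
  rw [TwistedLE, if_neg h]

theorem le_iff_of_crossing (h : Crossing x.carrier y.carrier) :
    x ≤ y ↔ x.carrier.reflect ≤ y.carrier := by
  change TwistedLE _ _ ↔ _
  rw [TwistedLE, if_pos h]

/-- The elements `a k` (for `c = 0`) and `b k` (for `c = coordSum`) of the configuration violating
the law. For `1 ≤ k ≤ m + 3` the rectangle `Cosupp × Supp` consists of the two edges at the vertex
`(k - 1)'`. Other values of `k` are allowed only because the law is stated for sequences. -/
def point (c : (Fin (m + 3) → ZMod 3) →ₗ[ZMod 3] ZMod 3) (k : ℕ) : TwistedLattice.{u} m where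
  carrier := graphOn (fun s => (s : ℕ) + 1 = k)
    (fun t => (t : ℕ) + 1 = k ∨ (t : ℕ) + 2 = k ∨ (k = 1 ∧ (t : ℕ) = m + 2)) c
  isCyclic := isCyclic_graphOn fun t s => by simp only [Edge]; omega

/-- For `1 ≤ k < m + 3`, the subspace of the pairs `(x, y)` with `y` supported at `k - 1` and `k`
and with `c y` as coordinate of `x` at `k - 1`. The rectangle `Cosupp × Supp` consists of the two
edges at the vertex `k - 1`. -/
def line (c : (Fin (m + 3) → ZMod 3) →ₗ[ZMod 3] ZMod 3) (k : ℕ) : TwistedLattice.{u} m where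
  carrier := graphOn (fun s => (s : ℕ) + 1 = k ∨ (s : ℕ) = k) (fun t => (t : ℕ) + 1 = k) c
  isCyclic := isCyclic_graphOn fun t s => by simp only [Edge]; omega

/-- The analogue of `line` at the last vertex `m + 2`, whose edges end in `(m + 2)'` and `0'`. -/
def lastLine (c : (Fin (m + 3) → ZMod 3) →ₗ[ZMod 3] ZMod 3) : TwistedLattice.{u} m where
  carrier := graphOn (fun s => (s : ℕ) = 0 ∨ (s : ℕ) = m + 2) (fun t => (t : ℕ) = m + 2) c
  isCyclic := isCyclic_graphOn fun t s => by simp only [Edge]; omega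

/-- `sumZero` as an element of the twisted lattice. -/
def hyperplane (m : ℕ) : TwistedLattice.{u} m where
  carrier := sumZero m
  isCyclic := fun _ _ h => absurd h not_cosupp_sumZero

/-- `diagonalLine` as an element of the twisted lattice. -/
def center (m : ℕ) : TwistedLattice.{u} m where
  carrier := diagonalLine m
  isCyclic := fun _ _ _ h => absurd h not_supp_diagonalLine

theorem sum_eq_of_forall_ne {y : Fin (m + 3) → ZMod 3} (k : Fin (m + 3))
    (h : ∀ j, j ≠ k → y j = 0) : ∑ j, y j = y k :=
  Finset.sum_eq_single k (fun j _ hj => h j hj) (by simp)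

theorem point_sup_point_le_line (c : (Fin (m + 3) → ZMod 3) →ₗ[ZMod 3] ZMod 3) {k : ℕ}
    (hk : 1 ≤ k) (hk' : k < m + 3) :
    (point c k ⊔ point c (k + 1) : TwistedLattice.{u} m) ≤ line c k := by
  refine sup_le ?_ ?_ <;> rw [le_iff_of_not_crossing]
  · rintro w ⟨h1, h2⟩
    exact ⟨fun j hj => h1 j (by tauto), fun j hj => h2 j (by tauto)⟩
  · rintro ⟨-, -, h3, -⟩
    have := cosupp_graphOn.1 h3
    simp at this
    omega
  · rintro w ⟨h1, h2⟩
    exact ⟨fun j hj => h1 j (by omega), fun j hj => h2 j (by omega)⟩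
  · rintro ⟨-, -, h3, -⟩
    have := cosupp_graphOn.1 h3
    simp at this
    omega

theorem line_inf_line_le_hyperplane {k : ℕ} (hk : 1 ≤ k) (hk' : k < m + 3) :
    (line 0 k ⊓ line (coordSum m) k : TwistedLattice.{u} m) ≤ hyperplane m := by
  have h1 : (line 0 k ⊓ line (coordSum m) k : TwistedLattice.{u} m) ≤ line 0 k := inf_le_left
  have h2 : (line 0 k ⊓ line (coordSum m) k : TwistedLattice.{u} m) ≤ line (coordSum m) k :=
    inf_le_right
  generalize (line 0 k ⊓ line (coordSum m) k : TwistedLattice.{u} m) = u at *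
  have hc : ∀ c, ¬ Crossing u.carrier (line.{u} c k).carrier := by
    rintro c ⟨-, -, h3, -⟩
    have := cosupp_graphOn.1 h3
    simp at this
    omega
  rw [le_iff_of_not_crossing (hc _)] at h1 h2
  rw [le_iff_of_not_crossing fun h => not_cosupp_sumZero h.2.2.1]
  intro w hw
  have e1 := (h1 hw).2 ⟨k - 1, by omega⟩ (by simp; omega)
  have e2 := (h2 hw).2 ⟨k - 1, by omega⟩ (by simp; omega)
  rw [e1, coordSum_apply] at e2
  exact e2.symm

/-- The last coordinate. -/
def lastCoord (m : ℕ) : (Fin (m + 3) → ZMod 3) →ₗ[ZMod 3] ZMod 3 :=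
  LinearMap.proj (Fin.last (m + 2))

/-- The functional of the line through `b 1` and `b (m + 3)`. Without the twist it would be the sum
of the last and the first coordinate; comparing `b 1` with this line reflects the former. -/
def lastDiff (m : ℕ) : (Fin (m + 3) → ZMod 3) →ₗ[ZMod 3] ZMod 3 :=
  lastCoord m - LinearMap.proj 0

theorem lastCoord_apply (y : Fin (m + 3) → ZMod 3) : lastCoord m y = y (Fin.last (m + 2)) := rfl

theorem lastDiff_apply (y : Fin (m + 3) → ZMod 3) :
    lastDiff m y = y (Fin.last (m + 2)) - y 0 := rfl

theorem crossing_lastLine {c : (Fin (m + 3) → ZMod 3) →ₗ[ZMod 3] ZMod 3} :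
    Crossing x.carrier (lastLine.{u} c).carrier ↔ x.carrier.Cosupp 0 ∧ x.carrier.Supp 0 :=
  ⟨fun h => ⟨h.1, h.2.1⟩, fun h => ⟨h.1, h.2, cosupp_graphOn.2 (by simp),
    supp_graphOn.2 (by simp), fun h => by simpa using cosupp_graphOn.1 h⟩⟩

theorem crossing_point_one_lastLine (c c' : (Fin (m + 3) → ZMod 3) →ₗ[ZMod 3] ZMod 3) :
    Crossing (point.{u} c 1).carrier (lastLine.{u} c').carrier :=
  crossing_lastLine.2 ⟨cosupp_graphOn.2 (by simp), supp_graphOn.2 (by simp)⟩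

theorem not_crossing_point (c : (Fin (m + 3) → ZMod 3) →ₗ[ZMod 3] ZMod 3) {k : ℕ} (hk : k ≠ 1) :
    ¬ Crossing (point.{u} c k).carrier y.carrier := by
  rintro ⟨-, h, -⟩
  have := supp_graphOn.1 h
  simp at this
  omega

theorem point_one_sup_point_last_le :
    (point (coordSum m) 1 ⊔ point (coordSum m) (m + 3) : TwistedLattice.{u} m) ≤
      lastLine (lastDiff m) := by
  refine sup_le ?_ ?_
  · rw [le_iff_of_crossing (crossing_point_one_lastLine _ _)]
    intro w hw
    obtain ⟨h1, h2⟩ := mem_graphOn.1 (mem_reflect.1 hw)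
    simp only [coordSum_apply, Pi.neg_apply, neg_eq_zero, Finset.sum_neg_distrib] at h1 h2
    refine ⟨fun j hj => h1 j (by omega), fun j hj => ?_⟩
    have h3 : ∑ j, w.2 j = w.2 0 := sum_eq_of_forall_ne 0 fun j hj => h1 j (by
      simp only [← Fin.val_ne_iff, Fin.val_zero] at hj
      omega)
    have hj' : (j : ℕ) = m + 2 := hj
    rw [h2 j (by simp [hj']), h3, lastDiff_apply, h1 (Fin.last (m + 2)) (by simp), zero_sub]
  · rw [le_iff_of_not_crossing (not_crossing_point _ (by omega))]
    rintro w ⟨h1, h2⟩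
    refine ⟨fun j hj => h1 j (by omega), fun j hj => ?_⟩
    rw [h2 j (by omega), coordSum_apply, sum_eq_of_forall_ne (Fin.last (m + 2)), lastDiff_apply,
      h1 0 (by simp), sub_zero]
    intro j hj
    simp only [← Fin.val_ne_iff, Fin.val_last] at hj
    exact h1 j (by omega)

/-- The intersection consists of pairs with `y` supported at `0` and `m + 2`, where its coordinates
are `-s` and `s`, and with `2 s = -s` as last coordinate of `x`. -/
theorem hyperplane_inf_lastLine_le :
    (hyperplane m ⊓ lastLine (lastDiff m) : TwistedLattice.{u} m) ≤
      lastLine (-lastCoord m) := by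
  have h1 : (hyperplane m ⊓ lastLine (lastDiff m) : TwistedLattice.{u} m) ≤ hyperplane m :=
    inf_le_left
  have h2 : (hyperplane m ⊓ lastLine (lastDiff m) : TwistedLattice.{u} m) ≤
    lastLine (lastDiff m) := inf_le_right
  generalize (hyperplane m ⊓ lastLine (lastDiff m) : TwistedLattice.{u} m) = u at *
  rw [le_iff_of_not_crossing fun h => not_cosupp_sumZero h.2.2.1] at h1
  have key : sumZero m ⊓ (lastLine.{u} (lastDiff m)).carrier ≤
      (lastLine.{u} (-lastCoord m)).carrier := by
    rintro w ⟨hw, h3, h4⟩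
    have hw : ∑ k, w.2 k = 0 := hw
    refine ⟨h3, fun k hk => ?_⟩
    rw [h4 k hk]
    rw [Finset.sum_eq_add_of_mem 0 (Fin.last (m + 2)) (Finset.mem_univ _) (Finset.mem_univ _)
      (by simp [Fin.ext_iff]) (fun j _ hj => h3 j (by
        simp only [← Fin.val_ne_iff, Fin.val_zero, Fin.val_last] at hj
        omega))] at hw
    rw [lastDiff_apply, LinearMap.neg_apply, lastCoord_apply]
    -- `2 = -1` in the field with three elements
    have h3 : (3 : ZMod 3) = 0 := by decide
    linear_combination -hw + w.2 (Fin.last (m + 2)) * h3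
  by_cases hc : Crossing u.carrier (lastLine.{u} (lastDiff m)).carrier
  · rw [le_iff_of_crossing hc] at h2
    rw [le_iff_of_crossing (crossing_lastLine.2 (crossing_lastLine.1 hc))]
    have h1' := reflect_mono h1
    have e : (hyperplane.{u} m).carrier.reflect = sumZero m :=
      reflect_eq_of_cosupp fun t => not_cosupp_sumZero
    rw [e] at h1'
    exact (le_inf h1' h2).trans key
  · have hc' : ¬ Crossing u.carrier (lastLine.{u} (-lastCoord m)).carrier := fun h =>
      hc (crossing_lastLine.2 (crossing_lastLine.1 h))
    rw [le_iff_of_not_crossing hc] at h2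
    rw [le_iff_of_not_crossing hc']
    exact (le_inf h1 h2).trans key

theorem point_one_le_lastLine :
    (point 0 1 : TwistedLattice.{u} m) ≤ lastLine (-lastCoord m) := by
  rw [le_iff_of_crossing (crossing_point_one_lastLine _ _)]
  intro w hw
  obtain ⟨h1, h2⟩ := mem_graphOn.1 (mem_reflect.1 hw)
  simp only [Pi.neg_apply, neg_eq_zero, LinearMap.zero_apply] at h1 h2
  refine ⟨fun j hj => h1 j (by omega), fun j hj => ?_⟩
  have hj' : (j : ℕ) = m + 2 := hj
  rw [h2 j (by simp [hj']), LinearMap.neg_apply, lastCoord_apply, h1 (Fin.last (m + 2)) (by simp),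
    neg_zero]

theorem center_le_sup {k : ℕ} (hk : 1 ≤ k) (hk' : k ≤ m + 3) :
    center m ≤ (point 0 k ⊔ point (coordSum m) k : TwistedLattice.{u} m) := by
  have h1 : point 0 k ≤ (point 0 k ⊔ point (coordSum m) k : TwistedLattice.{u} m) := le_sup_left
  have h2 : point (coordSum m) k ≤ (point 0 k ⊔ point (coordSum m) k : TwistedLattice.{u} m) :=
    le_sup_right
  generalize (point 0 k ⊔ point (coordSum m) k : TwistedLattice.{u} m) = u at *
  rw [le_iff_of_not_crossing fun h => not_supp_diagonalLine h.2.1]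
  rintro ⟨x, y⟩ ⟨hy, hx⟩
  obtain rfl : y = 0 := hy
  let l : Fin (m + 3) := ⟨k - 1, by omega⟩
  have hl : ∀ j : Fin (m + 3), ¬ (j : ℕ) + 1 = k → j ≠ l := by
    rintro j hj rfl
    exact hj (by simp [l]; omega)
  -- `(x, 0)` is the difference of elements of the two points with the same second component; this
  -- remains true if both points are reflected.
  have p0 : ∀ r : ZMod 3, ((0, Pi.single l r) : DoubleSpace m) ∈ (point.{u} 0 k).carrier :=
    fun r => ⟨fun j hj => by simp [hl j hj], fun j _ => by simp⟩
  have p1 : ((x, Pi.single l (x l)) : DoubleSpace m) ∈ (point.{u} (coordSum m) k).carrier :=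
    ⟨fun j hj => by simp [hl j hj], fun j _ => by
      rw [coordSum_apply, sum_eq_of_forall_ne l (fun j hj => by simp [hj])]
      simpa using hx j l⟩
  by_cases hc : Crossing (point.{u} 0 k).carrier u.carrier
  · have hc' : Crossing (point.{u} (coordSum m) k).carrier u.carrier := by
      by_cases hk1 : k = 1
      · subst hk1
        exact ⟨cosupp_graphOn.2 (by simp), supp_graphOn.2 (by simp), hc.2.2⟩
      · exact absurd hc (not_crossing_point _ hk1)
    rw [le_iff_of_crossing hc] at h1
    rw [le_iff_of_crossing hc'] at h2
    have := sub_mem (h2 (x := (x, -Pi.single l (x l))) (by simpa [mem_reflect] using p1))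
      (h1 (x := (0, -Pi.single l (x l))) (by simpa [mem_reflect] using p0 (x l)))
    simpa using this
  · have hc' : ¬ Crossing (point.{u} (coordSum m) k).carrier u.carrier := by
      by_cases hk1 : k = 1
      · subst hk1
        exact fun h => hc ⟨cosupp_graphOn.2 (by simp), supp_graphOn.2 (by simp), h.2.2⟩
      · exact not_crossing_point _ hk1
    rw [le_iff_of_not_crossing hc] at h1
    rw [le_iff_of_not_crossing hc'] at h2
    have := sub_mem (h2 p1) (h1 (p0 (x l)))
    simpa using this

theorem point_last_le_sup :
    point 0 (m + 3) ≤ (center m ⊔ point (coordSum m) (m + 3) : TwistedLattice.{u} m) := by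
  have h1 : center m ≤ (center m ⊔ point (coordSum m) (m + 3) : TwistedLattice.{u} m) :=
    le_sup_left
  have h2 : point (coordSum m) (m + 3) ≤
    (center m ⊔ point (coordSum m) (m + 3) : TwistedLattice.{u} m) := le_sup_right
  generalize (center m ⊔ point (coordSum m) (m + 3) : TwistedLattice.{u} m) = u at *
  rw [le_iff_of_not_crossing fun h => not_supp_diagonalLine h.2.1] at h1
  rw [le_iff_of_not_crossing (not_crossing_point _ (by omega))] at h2 ⊢
  rintro ⟨x, y⟩ ⟨hy, hx⟩
  have e : ((x, y) : DoubleSpace m) = (x + fun _ => ∑ j, y j, y) - (fun _ => ∑ j, y j, 0) := by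
    simp
  rw [e]
  refine sub_mem (h2 ⟨hy, fun k hk => ?_⟩) (h1 ⟨rfl, fun _ _ => rfl⟩)
  have := hx k hk
  simp only [LinearMap.zero_apply] at this
  simp [coordSum_apply, this]

theorem not_point_last_le_lastLine :
    ¬ (point 0 (m + 3) : TwistedLattice.{u} m) ≤
      lastLine (-lastCoord m) := by
  rw [le_iff_of_not_crossing (not_crossing_point _ (by omega))]
  intro h
  have := (h (x := (0, Pi.single (Fin.last (m + 2)) 1)) ⟨fun k hk => ?_, by simp⟩).2
    (Fin.last (m + 2)) (by simp)
  · simp [lastCoord_apply] at this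
  · have : k ≠ Fin.last (m + 2) := by
      rintro rfl
      simp at hk
    simp [this]

/-- The sequences `point 0` and `point (coordSum m)` violate the law: its left side is
`point 0 (m + 3)`, while its right side is at most `lastLine (-lastCoord m)`. -/
theorem not_arguesianLaw : ¬ ArguesianLaw (m + 3) (TwistedLattice.{u} m) := by
  intro hD
  have hD := hD (Finset.nonempty_Ico.2 (by omega)) (point 0) (point (coordSum m))
  refine not_point_last_le_lastLine.{u} (m := m) (le_trans (le_inf le_rfl ?_) (hD.trans ?_))
  · refine point_last_le_sup.trans (sup_le_sup_right (Finset.le_inf' _ _ fun k hk => ?_) _)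
    rw [Finset.mem_Ico] at hk
    exact center_le_sup hk.1 hk.2.le
  · refine sup_le point_one_le_lastLine (le_trans (inf_le_inf (Finset.sup'_le _ _ fun k hk => ?_)
      point_one_sup_point_last_le) hyperplane_inf_lastLine_le)
    rw [Finset.mem_Ico] at hk
    exact (inf_le_inf (point_sup_point_le_line _ hk.1 hk.2)
      (point_sup_point_le_line _ hk.1 hk.2)).trans (line_inf_line_le_hyperplane hk.1 hk.2)

end TwistedLattice

/-! ### Non-axiomatizability -/

theorem mainTheorem2 :
    (¬ ∃ S : Set LatticeHornSentence, S.Finite ∧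
      ∀ (L : Type u) [Lattice L], (∀ φ ∈ S, φ.Holds L) ↔ UnboundedOrderArguesian L) ∧
    (∀ N : ℕ, 3 ≤ N → ∃ (A : Type u) (_ : Lattice A), Finite A ∧
      ¬ ArguesianLaw N A ∧
      ∀ S : Set LatticeHornSentence, S.Finite →
        (∀ φ ∈ S, ∀ (L : Type u) [Lattice L], UnboundedOrderArguesian L → φ.Holds L) →
        (∀ φ ∈ S, φ.numVars < N) →
        ∀ φ ∈ S, φ.Holds A) := by
  constructor
  · rintro ⟨S, hS, h⟩
    obtain ⟨m, hm⟩ := (hS.image LatticeHornSentence.numVars).bddAbove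
    refine TwistedLattice.not_arguesianLaw.{u} (m := m) ((h _).1 (fun φ hφ => ?_) (m + 3)
      (by omega))
    have := hm (Set.mem_image_of_mem _ hφ)
    exact TwistedLattice.holds_of_numVars_lt (by omega) fun L _ hL => (h L).2 hL φ hφ
  · intro N hN
    obtain ⟨m, rfl⟩ := Nat.exists_eq_add_of_le' hN
    exact ⟨TwistedLattice.{u} m, inferInstance, inferInstance, TwistedLattice.not_arguesianLaw,
      fun S _ hS hk φ hφ => TwistedLattice.holds_of_numVars_lt (hk φ hφ) fun L _ => hS φ hφ L⟩
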